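/- Let $(R,\mathfrak m)$ be a Cohen–Macaulay (Noetherian) local ring of dimension $d\ge 3$ with infinite residue field, and let $I$ be an $\mathfrak m$-primary ideal of $R$. Let $\operatorname{gr}(I)=\bigoplus_{n\ge 0} I^n/I^{n+1}$ be the associated graded ring, and let $\operatorname{depth}\operatorname{gr}(I)$ denote its depth with respect to the homogeneous maximal ideal $\mathfrak m/I\oplus\bigoplus_{n\ge1}I^n/I^{n+1}$, that is, the supremum of the lengths of regular sequences contained in that ideal. For $n\in\mathbb Z$ let $H_I(n)=\lambda(R/I^n)$ (length, with $I^n=R$ for $n\le 0$), let $P_I\in\mathbb Q[X]$ be the Hilbert–Samuel polynomial, i.e. the polynomial with $P_I(n)=H_I(n)$ for all $n\gg0$, and let $$\operatorname{n}(I)=\min\{n\in\mathbb Z : P_I(t)=H_I(t)\text{ for all integers } t>n\}$$ be the postulation number of $I$. A reduction of $I$ is an ideal $J\subseteq I$ with $JI^n=I^{n+1}$ for some $n\ge 0$; the smallest such $n$ is denoted $\operatorname{rd}_J(I)$. A reduction is minimal if it is minimal with respect to inclusion among all reductions of $I$, and the reduction number of $I$ is $$\operatorname{rd}(I)=\min\{\operatorname{rd}_J(I):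 J \text{ is a minimal reduction of } I\}.$$ Suppose that $\operatorname{depth}\operatorname{gr}(I)=d-2$. If $\operatorname{n}(I)<-(d-3)$, then $\operatorname{rd}(I)\ge \operatorname{n}(I)+d$. -/

import Mathlib

open IsLocalRing Polynomial

noncomputable section

/-- The depth (grade) of a commutative ring `A` in an ideal `𝔞`: the supremum of the lengths of the
`A`-regular sequences consisting of elements of `𝔞`. -/
def depthIn {A : Type*} [CommRing A] (𝔞 : Ideal A) : ℕ∞ :=
  ⨆ rs ∈ {rs : List A | (∀ r ∈ rs, r ∈ 𝔞) ∧ RingTheory.Sequence.IsRegular A rs}, (rs.length : ℕ∞)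

/-- A Noetherian local ring is Cohen–Macaulay if its depth (in the maximal ideal) equals its Krull
dimension. -/
structure IsCohenMacaulayLocalRing (R : Type*) [CommRing R] [IsLocalRing R] : Prop where
  isNoetherianRing : IsNoetherianRing R
  depth_eq_dim : ((depthIn (maximalIdeal R) : ℕ∞) : WithBot ℕ∞) = ringKrullDim R

/-- `I` is `𝔪`-primary: a primary ideal whose radical is the maximal ideal `𝔪`. -/
def IsMaximalPrimary {R : Type*} [CommRing R] [IsLocalRing R] (I : Ideal R) : Prop :=
  I.IsPrimary ∧ I.radical = maximalIdeal R

/-! ### The associated graded ring -/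

/-- The ideal `⨁ₙ Iⁿ⁺¹ tⁿ` of the Rees algebra `⨁ₙ Iⁿ tⁿ`. -/
def reesShift {R : Type*} [CommRing R] (I : Ideal R) : Ideal (reesAlgebra I) where
  carrier := {f | ∀ n, (f : R[X]).coeff n ∈ I ^ (n + 1)}
  add_mem' hf hg n := by
    simpa using Ideal.add_mem _ (hf n) (hg n)
  zero_mem' n := by simp
  smul_mem' c f hf n := by
    simp only [smul_eq_mul, MulMemClass.coe_mul, coeff_mul]
    refine Ideal.sum_mem _ ?_
    rintro ⟨j, k⟩ e
    rw [← Finset.HasAntidiagonal.mem_antidiagonal.mp e, add_assoc, pow_add]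
    exact Ideal.mul_mem_mul (c.2 j) (hf k)

/-- The associated graded ring `gr(I) = ⨁ₙ Iⁿ / Iⁿ⁺¹`, as the quotient of the Rees algebra
`⨁ₙ Iⁿ tⁿ` by its ideal `⨁ₙ Iⁿ⁺¹ tⁿ`. -/
abbrev AssocGraded {R : Type*} [CommRing R] (I : Ideal R) : Type _ :=
  reesAlgebra I ⧸ reesShift I

/-- The ideal `𝔪 ⊕ ⨁_{n ≥ 1} Iⁿ tⁿ` of the Rees algebra of an ideal of a local ring. -/
def reesMaximalIdeal {R : Type*} [CommRing R] [IsLocalRing R] (I : Ideal R) :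
    Ideal (reesAlgebra I) :=
  (maximalIdeal R).comap ((constantCoeff (R := R)).comp (reesAlgebra I).val.toRingHom)

/-- The depth of `gr(I)`, taken in its homogeneous maximal ideal
`𝔪/I ⊕ ⨁_{n ≥ 1} Iⁿ / Iⁿ⁺¹`. -/
def depthGr {R : Type*} [CommRing R] [IsLocalRing R] (I : Ideal R) : ℕ∞ :=
  depthIn (A := AssocGraded I) ((reesMaximalIdeal I).map (Ideal.Quotient.mk (reesShift I)))

/-! ### Reductions and reduction numbers -/

/-- `J` is a reduction of `I`: `J ⊆ I` and `J Iⁿ = Iⁿ⁺¹` for some natural number `n`. -/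
def IsReduction {R : Type*} [CommRing R] (J I : Ideal R) : Prop :=
  J ≤ I ∧ ∃ n : ℕ, J * I ^ n = I ^ (n + 1)

/-- `J` is a minimal reduction of `I`: minimal for inclusion among the reductions of `I`. -/
def IsMinimalReduction {R : Type*} [CommRing R] (J I : Ideal R) : Prop :=
  Minimal (fun K : Ideal R => IsReduction K I) J

/-- The reduction number `rd_J(I)`: the smallest `n` such that `J Iⁿ = Iⁿ⁺¹`. -/
def reductionNumberWrt {R : Type*} [CommRing R] (J I : Ideal R) : ℕ :=
  sInf {n : ℕ | J * I ^ n = I ^ (n + 1)}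

/-- The reduction number `rd(I)`: the minimum of `rd_J(I)` over all minimal reductions `J`. -/
def reductionNumber {R : Type*} [CommRing R] (I : Ideal R) : ℕ :=
  sInf {r : ℕ | ∃ J : Ideal R, IsMinimalReduction J I ∧ r = reductionNumberWrt J I}

/-! ### Hilbert–Samuel function and postulation number -/

/-- The Hilbert–Samuel function `H_I(n) = λ(R/Iⁿ)` for `n ∈ ℤ`, where `Iⁿ = R` for `n ≤ 0`
(so that `H_I(n) = 0` there). -/
def hilbertSamuelFunction {R : Type*} [CommRing R] (I : Ideal R) (n : ℤ) : ℕ :=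
  (Module.length R (R ⧸ I ^ n.toNat)).toNat

/-- `P` is a Hilbert–Samuel polynomial of `I`: `P(n) = H_I(n)` for all large `n`.
There is at most one such `P`. -/
def IsHilbertSamuelPolynomial {R : Type*} [CommRing R] (I : Ideal R) (P : ℚ[X]) : Prop :=
  ∃ N : ℤ, ∀ n : ℤ, N ≤ n → P.eval (n : ℚ) = (hilbertSamuelFunction I n : ℚ)

open Classical in
/-- The Hilbert–Samuel polynomial `P_I`. It exists when `R` is Noetherian local and `I` is
`𝔪`-primary (Samuel); the value is `0` when there is none. -/
def hilbertSamuelPolynomial {R : Type*} [CommRing R] (I : Ideal R) : ℚ[X] :=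
  if h : ∃ P : ℚ[X], IsHilbertSamuelPolynomial I P then h.choose else 0

/-- The postulation number `n(I) = min {n ∈ ℤ : P_I(t) = H_I(t) for all t > n}`. If `dim R > 0`
and `I` is `𝔪`-primary, this set is nonempty and bounded below, so that the infimum in `ℤ` is a
minimum. -/
def postulationNumber {R : Type*} [CommRing R] (I : Ideal R) : ℤ :=
  sInf {n : ℤ | ∀ t : ℤ, n < t →
    (hilbertSamuelPolynomial I).eval (t : ℚ) = (hilbertSamuelFunction I t : ℚ)}

end

/-! The postulation number enters only through integer arithmetic. Its bound gives n(I) + d ≤ 2, so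
a failure of the conclusion forces rd(I) ≤ 1. Then some minimal reduction J satisfies J I = I²,
hence J ∩ Iⁿ⁺¹ = J Iⁿ for all n. Superficial elements show that J is generated by a regular sequence
of length d (`exists_isRegular_isReduction`). By the Valabrega–Valla criterion
(`isRegular_initialForms`) the initial forms of that sequence are regular in gr(I), so depth gr(I) ≥
d, against d - 2. -/

/-! ### Existence of minimal reductions -/

section MinimalReduction

variable {R : Type*} [CommRing R]

theorem isReduction_self (I : Ideal R) : IsReduction I I :=
  ⟨le_rfl, 0, by simp⟩

theorem IsReduction.trans {K J I : Ideal R} (hK : IsReduction K J) (hJ : IsReduction J I) :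
    IsReduction K I := by
  obtain ⟨hKJ, m, hm⟩ := hK
  obtain ⟨hJI, n, hn⟩ := hJ
  have key : ∀ k, J ^ k * I ^ n = I ^ (n + k) := by
    intro k
    induction k with
    | zero => simp
    | succ k ih =>
      rw [pow_succ', mul_assoc, ih, pow_add, ← mul_assoc, hn, ← pow_add]
      congr 1
      ring
  refine ⟨hKJ.trans hJI, n + m, ?_⟩
  rw [← key m, ← mul_assoc, hm, key, add_assoc]

variable [IsLocalRing R]

/-- Nakayama's lemma for reductions. -/
theorem IsReduction.of_le_sup [IsNoetherianRing R] {J K I : Ideal R} (hJ : IsReduction J I) (hKI : K ≤ I)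
    (h : J ≤ K ⊔ maximalIdeal R * I) : IsReduction K I := by
  obtain ⟨-, n, hn⟩ := hJ
  refine ⟨hKI, n, le_antisymm ?_ ?_⟩
  · rw [pow_succ']
    exact Ideal.mul_mono_left hKI
  · refine Submodule.le_of_le_smul_of_le_jacobson_bot (I := maximalIdeal R)
      (IsNoetherian.noetherian _) (maximalIdeal_le_jacobson ⊥) ?_
    calc I ^ (n + 1) = J * I ^ n := hn.symm
      _ ≤ (K ⊔ maximalIdeal R * I) * I ^ n := Ideal.mul_mono_left h
      _ = K * I ^ n ⊔ maximalIdeal R • I ^ (n + 1) := by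
        rw [Ideal.sup_mul, mul_assoc, ← pow_succ', smul_eq_mul]

/-- A unit coefficient in a combination lying in 𝔪I would make its generator redundant modulo 𝔪I. -/
theorem span_inf_maximalIdeal_mul_le [DecidableEq R] {I : Ideal R} {S : Finset R}
    (hmin : ∀ s ∈ S, ¬ Ideal.span (S : Set R) ≤
      Ideal.span ((S.erase s : Finset R) : Set R) ⊔ maximalIdeal R * I) :
    Ideal.span (S : Set R) ⊓ maximalIdeal R * I ≤ maximalIdeal R * Ideal.span (S : Set R) := by
  rintro a ⟨haS, haI⟩
  obtain ⟨f, -, rfl⟩ := Submodule.mem_span_finset.mp haS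
  refine Ideal.sum_mem _ fun s hs => ?_
  by_cases hf : f s ∈ maximalIdeal R
  · exact Ideal.mul_mem_mul hf (Ideal.subset_span hs)
  refine absurd (Ideal.span_le.mpr fun t ht => ?_) (hmin s hs)
  by_cases hts : t = s
  · subst hts
    have hu : IsUnit (f t) := by simpa using hf
    rw [← Finset.add_sum_erase S _ hs] at haI
    have hrest : ∑ x ∈ S.erase t, f x • x ∈ Ideal.span ((S.erase t : Finset R) : Set R) :=
      Ideal.sum_mem _ fun x hx => Ideal.mul_mem_left _ _ (Ideal.subset_span hx)
    have hmem : f t * t ∈ Ideal.span ((S.erase t : Finset R) : Set R) ⊔ maximalIdeal R * I := by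
      have := Ideal.sub_mem (Ideal.span ((S.erase t : Finset R) : Set R) ⊔ maximalIdeal R * I)
        (Ideal.mem_sup_right haI) (Ideal.mem_sup_left hrest)
      simpa using this
    exact (Ideal.unit_mul_mem_iff_mem _ hu).mp hmem
  · exact Ideal.mem_sup_left (Ideal.subset_span (Finset.mem_coe.mpr (Finset.mem_erase.mpr ⟨hts, ht⟩)))

/-- Northcott–Rees: minimal reductions exist. -/
theorem exists_isMinimalReduction [IsNoetherianRing R] {I : Ideal R} (hI : I.radical = maximalIdeal R) :
    ∃ J : Ideal R, IsMinimalReduction J I := by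
  classical
  -- Descending chains of reductions need not stop in R, but their images in the Artinian ring R/𝔪I
  -- do.
  have hart : IsArtinianRing (R ⧸ maximalIdeal R * I) := by
    refine IsLocalRing.quotient_artinian_of_mem_minimalPrimes_of_isLocalRing _
      ⟨⟨inferInstance, Ideal.mul_le_right.trans (le_maximalIdeal ?_)⟩, fun p ⟨hp, hle⟩ _ => ?_⟩
    · rintro rfl
      rw [Ideal.radical_top] at hI
      exact (maximalIdeal.isMaximal R).ne_top hI.symm
    · rcases hp.mul_le.mp hle with h | h
      · exact h
      · rw [← hI]
        exact hp.radical_le_iff.mpr h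
  let q : Ideal R → Ideal (R ⧸ maximalIdeal R * I) := Ideal.map (Ideal.Quotient.mk _)
  have hq : ∀ {A B : Ideal R}, q A ≤ q B ↔ A ≤ B ⊔ maximalIdeal R * I := by
    intro A B
    rw [Ideal.map_le_iff_le_comap,
      Ideal.comap_map_of_surjective _ Ideal.Quotient.mk_surjective, ← RingHom.ker_eq_comap_bot,
      Ideal.mk_ker]
  obtain ⟨_, ⟨J₀, hJ₀, rfl⟩, hJ₀min⟩ := (IsWellFounded.wf : WellFounded
    ((· < ·) : Ideal (R ⧸ maximalIdeal R * I) → _ → Prop)).has_min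
    (q '' {J | IsReduction J I}) ⟨_, I, isReduction_self I, rfl⟩
  let C : Set (Finset R) := {S | (S : Set R) ⊆ J₀ ∧ J₀ ≤ Ideal.span (S : Set R) ⊔ maximalIdeal R * I}
  have hC : C.Nonempty := by
    obtain ⟨S, hS⟩ := IsNoetherian.noetherian J₀
    refine ⟨S, ?_, ?_⟩
    · rw [← hS]; exact Submodule.subset_span
    · exact hS.ge.trans le_sup_left
  obtain ⟨S, ⟨hSJ, hJS⟩, hSmin⟩ := (InvImage.wf Finset.card Nat.lt_wfRel.wf).has_min C hC
  have hKJ : Ideal.span (S : Set R) ≤ J₀ := Ideal.span_le.mpr hSJ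
  refine ⟨Ideal.span S, hJ₀.of_le_sup (hKJ.trans hJ₀.1) hJS, fun K' hK' hle => ?_⟩
  -- K' ⊆ J₀ is again a reduction, so minimality makes their images in R/𝔪I equal.
  have hJK' : J₀ ≤ K' ⊔ maximalIdeal R * I := by
    have h1 : q K' ≤ q J₀ := Ideal.map_mono (hle.trans hKJ)
    have h2 := hJ₀min _ ⟨K', hK', rfl⟩
    exact hq.mp (by_contra fun h => h2 (lt_of_le_not_ge h1 h))
  refine Submodule.le_of_le_smul_of_le_jacobson_bot (I := maximalIdeal R)
    (IsNoetherian.noetherian _) (maximalIdeal_le_jacobson ⊥) ?_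
  have hinf := span_inf_maximalIdeal_mul_le (I := I) (S := S) fun s hs h =>
    hSmin (S.erase s) ⟨(Finset.coe_subset.mpr (S.erase_subset s)).trans hSJ,
      hJS.trans (sup_le h le_sup_right)⟩ (Finset.card_erase_lt_of_mem hs)
  -- The modular law applies because K' ⊆ (S); Nakayama then gives (S) ⊆ K'.
  calc Ideal.span (S : Set R)
      ≤ (K' ⊔ maximalIdeal R * I) ⊓ Ideal.span (S : Set R) := le_inf (hKJ.trans hJK') le_rfl
    _ = K' ⊔ maximalIdeal R * I ⊓ Ideal.span (S : Set R) := sup_inf_assoc_of_le _ hle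
    _ ≤ K' ⊔ maximalIdeal R • Ideal.span (S : Set R) :=
      sup_le_sup_left ((inf_comm _ _).trans_le hinf) _

end MinimalReduction

/-! ### Avoidance of finitely many submodules -/

section Avoidance

variable {R : Type*} [CommRing R] [IsLocalRing R] [Infinite (ResidueField R)]

/-- A module over a local ring with infinite residue field is not a finite union of proper
submodules. -/
theorem exists_forall_notMem_of_ne_top {M : Type*} [AddCommGroup M] [Module R M]
    {ι : Type*} (s : Finset ι) (W : ι → Submodule R M) (hW : ∀ i ∈ s, W i ≠ ⊤) :
    ∃ x, ∀ i ∈ s, x ∉ W i := by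
  classical
  induction s using Finset.induction_on with
  | empty => exact ⟨0, by simp⟩
  | insert j s hj ih =>
    obtain ⟨x, hx⟩ := ih fun i hi => hW i (Finset.mem_insert_of_mem hi)
    obtain ⟨y, hy⟩ : ∃ y, y ∉ W j := by
      by_contra! h
      exact hW j (Finset.mem_insert_self _ _) (eq_top_iff.mpr fun z _ => h z)
    -- On the line x + uy each submodule excludes at most one residue class of u: two classes would
    -- put both y and x in it.
    have huniq : ∀ i ∈ insert j s, ∀ u v : R, x + u • y ∈ W i → x + v • y ∈ W i →
        residue R u = residue R v := by
      intro i hi u v hu hv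
      by_contra hne
      have hunit : IsUnit (u - v) := by
        rw [← residue_ne_zero_iff_isUnit, map_sub]
        exact sub_ne_zero.mpr hne
      have hyi : y ∈ W i := by
        have h : (u - v) • y ∈ W i := by
          convert (W i).sub_mem hu hv using 1
          rw [sub_smul]; abel
        exact (Submodule.smul_mem_iff_of_isUnit _ hunit).mp h
      have hxi : x ∈ W i := by
        simpa using (W i).sub_mem hu ((W i).smul_mem u hyi)
      rcases Finset.mem_insert.mp hi with rfl | hi
      · exact hy hyi
      · exact hx i hi hxi
    let bad : ι → ResidueField R := fun i =>
      if h : ∃ u : R, x + u • y ∈ W i then residue R h.choose else 0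
    obtain ⟨t, ht⟩ := Infinite.exists_notMem_finset ((insert j s).image bad)
    obtain ⟨u, rfl⟩ := residue_surjective t
    refine ⟨x + u • y, fun i hi hmem => ht (Finset.mem_image.mpr ⟨i, hi, ?_⟩)⟩
    have h : ∃ u : R, x + u • y ∈ W i := ⟨u, hmem⟩
    simp only [bad, dif_pos h]
    exact huniq i hi _ _ h.choose_spec hmem

end Avoidance

/-! ### Superficial elements -/

section Superficial

variable {R : Type*} [CommRing R]

/-- The inclusion of an ideal `I` as the degree one component `I t` of its Rees algebra. -/
noncomputable def reesDegreeOne (I : Ideal R) : I →ₗ[R] reesAlgebra I where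
  toFun x := ⟨monomial 1 (x : R), reesAlgebra.monomial_mem.mpr (by simp)⟩
  map_add' x y := Subtype.ext (by simp)
  map_smul' r x := Subtype.ext (by simp [smul_monomial])

theorem coe_reesDegreeOne (I : Ideal R) (x : I) :
    (reesDegreeOne I x : R[X]) = monomial 1 (x : R) := rfl

theorem mem_reesShift {I : Ideal R} {f : reesAlgebra I} :
    f ∈ reesShift I ↔ ∀ n, (f : R[X]).coeff n ∈ I ^ (n + 1) := Iff.rfl

theorem monomial_mem_span_reesDegreeOne_pow (I : Ideal R) (n : ℕ) :
    ∀ a (ha : a ∈ I ^ n), (⟨monomial n a, reesAlgebra.monomial_mem.mpr ha⟩ : reesAlgebra I) ∈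
      Ideal.span (Set.range (reesDegreeOne I)) ^ n := by
  induction n with
  | zero => simp
  | succ n ih =>
    intro a ha
    have ha' := ha
    rw [pow_succ'] at ha'
    induction ha' using Submodule.mul_induction_on' with
    | mem_mul_mem x hx b hb =>
      have hx' : reesDegreeOne I ⟨x, hx⟩ ∈ Ideal.span (Set.range (reesDegreeOne I)) :=
        Ideal.subset_span ⟨_, rfl⟩
      have h := Ideal.mul_mem_mul hx' (ih b hb)
      rw [← pow_succ'] at h
      convert h using 1
      exact Subtype.ext (by simp [coe_reesDegreeOne, monomial_mul_monomial, add_comm])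
    | add x hx y hy h1 h2 =>
      rw [← pow_succ'] at hx hy
      convert Ideal.add_mem _ (h1 hx) (h2 hy) using 1
      exact Subtype.ext (by simp)

/-- A generic x ∈ J avoids the associated primes of R, while xt avoids the radicals of those primary
components of `reesShift J` that do not contain the ideal B generated by Jt. The other components
contain a power of B, so they impose nothing in high degree. -/
theorem exists_superficial [IsLocalRing R] [IsNoetherianRing R] [Infinite (ResidueField R)]
    {J : Ideal R} {y : R} (hyJ : y ∈ J) (hy : IsSMulRegular R y) :
    ∃ x ∈ J, IsSMulRegular R x ∧ ∃ n₀, ∀ n ≥ n₀, ∀ a, x * a ∈ J ^ (n + 1) → a ∈ J ^ n := by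
  classical
  obtain ⟨s, hs, hprim⟩ := Submodule.isLasker (reesAlgebra J) (reesAlgebra J) (reesShift J)
  let B : Ideal (reesAlgebra J) := Ideal.span (Set.range (reesDegreeOne J))
  have hexp : ∀ q : Ideal (reesAlgebra J), ∃ c, B ≤ q.radical → B ^ c ≤ q := by
    intro q
    by_cases h : B ≤ q.radical
    · obtain ⟨c, hc⟩ := Ideal.exists_pow_le_of_le_radical_of_fg h (IsNoetherian.noetherian _)
      exact ⟨c, fun _ => hc⟩
    · exact ⟨0, fun h' => absurd h' h⟩
  choose c hc using hexp
  let A : Finset (Ideal R) := (associatedPrimes.finite R R).toFinset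
  let T : Finset (Submodule R J) := A.image (Submodule.comap J.subtype) ∪
    (s.filter fun q => ¬ B ≤ Ideal.radical q).image
      fun q => (Submodule.restrictScalars R (Ideal.radical q)).comap (reesDegreeOne J)
  have hassoc : ∀ z : R, IsSMulRegular R z ↔ ∀ p ∈ A, z ∉ p := by
    intro z
    have := biUnion_associatedPrimes_eq_compl_regular R R
    rw [← not_iff_not, ← Set.mem_ofPred_eq (p := fun r => IsSMulRegular R r), ← Set.mem_compl_iff,
      ← this]
    simp [A]
  -- The submodules in T are proper: y lies in no associated prime, and B is not inside the selected
  -- radicals.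
  obtain ⟨x, hx⟩ := exists_forall_notMem_of_ne_top T id (by
    intro W hW htop
    rcases Finset.mem_union.mp hW with h | h
    · obtain ⟨p, hp, rfl⟩ := Finset.mem_image.mp h
      have : (⟨y, hyJ⟩ : J) ∈ Submodule.comap J.subtype p := by
        rw [show Submodule.comap J.subtype p = ⊤ from htop]; trivial
      exact (hassoc y).mp hy p hp this
    · obtain ⟨q, hq, rfl⟩ := Finset.mem_image.mp h
      refine (Finset.mem_filter.mp hq).2 (Ideal.span_le.mpr ?_)
      rintro _ ⟨z, rfl⟩
      have : z ∈ (Submodule.restrictScalars R (Ideal.radical q)).comap (reesDegreeOne J) := by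
        rw [id] at htop
        rw [htop]; trivial
      exact this)
  have hxreg : IsSMulRegular R (x : R) := (hassoc x).mpr fun p hp hxp =>
    hx _ (Finset.mem_union_left _ (Finset.mem_image_of_mem _ hp)) hxp
  have hxq : ∀ q ∈ s, ¬ B ≤ Ideal.radical q → reesDegreeOne J x ∉ Ideal.radical q :=
    fun q hq hB hmem => hx _ (Finset.mem_union_right _
      (Finset.mem_image_of_mem _ (Finset.mem_filter.mpr ⟨hq, hB⟩))) hmem
  have hstep : ∀ n ≥ s.sup c, ∀ a ∈ J ^ n, (x : R) * a ∈ J ^ (n + 2) → a ∈ J ^ (n + 1) := by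
    intro n hn a ha hxa
    let F : reesAlgebra J := ⟨monomial n a, reesAlgebra.monomial_mem.mpr ha⟩
    have hxF : F * reesDegreeOne J x ∈ reesShift J := by
      refine mem_reesShift.mpr fun m => ?_
      have : ((F * reesDegreeOne J x : reesAlgebra J) : R[X]) = monomial (n + 1) ((x : R) * a) := by
        simp [F, coe_reesDegreeOne, monomial_mul_monomial, mul_comm]
      rw [this, coeff_monomial]
      split_ifs with h
      · subst h; exact hxa
      · exact zero_mem _
    have hF : F ∈ reesShift J := by
      rw [← hs, Submodule.mem_finsetInf]
      intro q hq
      by_cases hB : B ≤ Ideal.radical q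
      · have h1 := monomial_mem_span_reesDegreeOne_pow J n a ha
        exact hc q hB (Ideal.pow_le_pow_right ((Finset.le_sup hq).trans hn) h1)
      · have h1 : F * reesDegreeOne J x ∈ q := by
          rw [← hs, Submodule.mem_finsetInf] at hxF
          exact hxF q hq
        exact ((Ideal.isPrimary_iff.mp (hprim hq)).2 h1).resolve_right (hxq q hq hB)
    simpa [F] using mem_reesShift.mp hF n
  -- Artin–Rees and cancellation of x place a in J^(n+1-k), deep enough to start climbing with
  -- `hstep`.
  obtain ⟨k, hk⟩ := Ideal.exists_pow_inf_eq_pow_smul J (Ideal.span {(x : R)})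
  refine ⟨x, x.2, hxreg, s.sup c + k, fun n hn a hxa => ?_⟩
  have hac : a ∈ J ^ (s.sup c) := by
    have h1 : (x : R) * a ∈ J ^ (n + 1) • (⊤ : Ideal R) ⊓ Ideal.span {(x : R)} :=
      ⟨by simpa using hxa, Ideal.mem_span_singleton.mpr (dvd_mul_right _ _)⟩
    rw [hk (n + 1) (by omega)] at h1
    have h2 : (x : R) * a ∈ Ideal.span {(x : R)} * J ^ (n + 1 - k) := by
      rw [mul_comm (Ideal.span _)]
      exact Ideal.mul_mono_right inf_le_right h1
    obtain ⟨b, hb, hab⟩ := Ideal.mem_span_singleton_mul.mp h2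
    rw [← hxreg hab]
    exact Ideal.pow_le_pow_right (by omega) hb
  have hind : ∀ j, s.sup c + j ≤ n → a ∈ J ^ (s.sup c + j) := by
    intro j
    induction j with
    | zero => exact fun _ => hac
    | succ j ih =>
      intro hj
      exact hstep _ (Nat.le_add_right _ _) a (ih (by omega))
        (Ideal.pow_le_pow_right (by omega) hxa)
  have := hind (n - s.sup c) (by omega)
  rwa [Nat.add_sub_cancel' (by omega)] at this

end Superficial

/-! ### Depth modulo a regular element -/

section DepthDrop

open RingTheory.Sequence CategoryTheory Abelian Limits Pointwise

universe u

/-- Dividing by a regular element lowers the depth by at most one. -/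
theorem exists_isRegular_quotSMulTop {R : Type u} [CommRing R] [IsLocalRing R] [IsNoetherianRing R]
    {rs : List R} {n : ℕ} (hlen : rs.length = n + 1) (hmem : ∀ r ∈ rs, r ∈ maximalIdeal R)
    (hrs : IsRegular R rs) {x : R} (hx : x ∈ maximalIdeal R) (hxreg : IsSMulRegular R x) :
    ∃ rs' : List R, rs'.length = n ∧ (∀ r ∈ rs', r ∈ maximalIdeal R) ∧
      IsRegular (QuotSMulTop x R) rs' := by
  let k : ModuleCat.{u} R := ModuleCat.of R (R ⧸ maximalIdeal R)
  have hsupp : Module.support R k = PrimeSpectrum.zeroLocus (maximalIdeal R) := by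
    rw [Module.support_eq_zeroLocus, Ideal.annihilator_quotient]
  have hlt : ∀ (N : Type u) [AddCommGroup N] [Module R N] [Module.Finite R N] [Nontrivial N],
      maximalIdeal R • (⊤ : Submodule R N) < ⊤ := fun N _ _ _ _ =>
    (Submodule.top_ne_ideal_smul_of_le_jacobson_annihilator
      (maximalIdeal_le_jacobson _)).symm.lt_top
  -- Rees's criterion: depth is detected by vanishing of Extⁱ(k, -). In the long exact sequence of
  -- multiplication by x, Extⁱ(k, R/x) sits between Extⁱ(k, R) and Extⁱ⁺¹(k, R).
  have hext := ModuleCat.subsingleton_ext_of_exists_isRegular (maximalIdeal R) k hsupp.subset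
    (ModuleCat.of R R) (hlt R) rs hmem hrs
  have := nontrivial_quotSMulTop_of_mem_maximalIdeal R hx
  refine ModuleCat.exists_isRegular_of_exists_subsingleton_ext (maximalIdeal R) n
    (ModuleCat.of R (QuotSMulTop x R)) (hlt _) k hsupp fun i hi => ?_
  have zero1 := AddCommGrpCat.isZero_of_iff_subsingleton.mpr (hext i (by omega))
  have zero2 := AddCommGrpCat.isZero_of_iff_subsingleton.mpr (hext (i + 1) (by omega))
  have hreg : IsSMulRegular (ModuleCat.of R R) x := hxreg
  exact AddCommGrpCat.subsingleton_of_isZero <| ShortComplex.Exact.isZero_of_both_zeros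
    ((Ext.covariant_sequence_exact₃' k hreg.smulShortComplex_shortExact) i (i + 1) rfl)
    (zero1.eq_zero_of_src _) (zero2.eq_zero_of_tgt _)

/-- This passes from the R-module R/xR to the ring R/(x), over which the induction on dimension
runs. -/
theorem isRegular_cons_iff_quotient_span {R : Type*} [CommRing R] (x : R) (rs : List R) :
    IsRegular R (x :: rs) ↔ IsSMulRegular R x ∧
      IsRegular (R ⧸ Ideal.span {x}) (rs.map (Ideal.Quotient.mk (Ideal.span {x}))) := by
  have hx : x • (⊤ : Ideal R) = Ideal.span {x} := by
    simp [← Submodule.ideal_span_singleton_smul]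
  let e : QuotSMulTop x R ≃ₗ[R] R ⧸ Ideal.span {x} := Submodule.quotEquivOfEq _ _ hx
  rw [isRegular_cons_iff']
  refine and_congr_right fun _ => AddEquiv.isRegular_congr (e := e.toAddEquiv) ?_
  rw [List.forall₂_same]
  intro r _ m
  obtain ⟨r, rfl⟩ := Ideal.Quotient.mk_surjective r
  exact e.map_smul r m

end DepthDrop

/-! ### Reductions generated by regular sequences -/

section RegularReduction

open RingTheory.Sequence

theorem infinite_residueField_of_surjective {R S : Type*} [CommRing R] [IsLocalRing R] [CommRing S]
    [IsLocalRing S] [Infinite (ResidueField R)] (f : R →+* S) (hf : Function.Surjective f) :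
    Infinite (ResidueField S) :=
  have := hf.isLocalHom f
  Infinite.of_injective (ResidueField.map f) (RingHom.injective _)

universe u

/-- In a Cohen–Macaulay local ring with infinite residue field, an `𝔪`-primary ideal has a reduction
generated by a regular sequence whose length is the dimension. -/
theorem exists_isRegular_isReduction (d : ℕ) :
    ∀ (R : Type u) [CommRing R] [IsLocalRing R] [IsNoetherianRing R] [Infinite (ResidueField R)],
      ringKrullDim R = d →
      (∃ rs : List R, rs.length = d ∧ (∀ r ∈ rs, r ∈ maximalIdeal R) ∧ IsRegular R rs) →
      ∀ (J : Ideal R), J ≤ maximalIdeal R → ∀ N, maximalIdeal R ^ N ≤ J →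
      ∃ rs : List R, rs.length = d ∧ (∀ r ∈ rs, r ∈ J) ∧ IsRegular R rs ∧
        IsReduction (Ideal.ofList rs) J := by
  induction d with
  | zero =>
    intro R _ _ _ _ hdim _ J hJm N hN
    have : Ring.KrullDimLE 0 R := by
      rw [Ring.krullDimLE_iff, hdim]
    have : IsArtinianRing R := isArtinianRing_iff_isNoetherianRing_krullDimLE_zero.mpr
      ⟨inferInstance, this⟩
    -- In dimension 0 the ideal J is nilpotent, so the zero ideal is a reduction.
    obtain ⟨n, hn⟩ := IsArtinianRing.isNilpotent_jacobson_bot (R := R)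
    rw [jacobson_eq_maximalIdeal ⊥ bot_ne_top] at hn
    have hJn : J ^ n = ⊥ := le_bot_iff.mp ((Ideal.pow_right_mono hJm n).trans hn.le)
    exact ⟨[], rfl, by simp, IsRegular.nil R R, by simp, n, by simp [pow_succ, hJn]⟩
  | succ d ih =>
    rintro R _ _ _ _ hdim ⟨as, haslen, hasmem, hasreg⟩ J hJm N hN
    obtain ⟨y, hyJ, hy⟩ : ∃ y ∈ J, IsSMulRegular R y := by
      match as, haslen with
      | a :: as, _ =>
        exact ⟨a ^ N, hN (Ideal.pow_mem_pow (hasmem a (by simp)) N),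
          ((isRegular_cons_iff R a as).mp hasreg).1.pow N⟩
    obtain ⟨x, hxJ, hx, n₀, hsup⟩ := exists_superficial hyJ hy
    obtain ⟨bs, hbslen, hbsmem, hbsreg⟩ := exists_isRegular_quotSMulTop haslen hasmem hasreg
      (hJm hxJ) hx
    let π : R →+* R ⧸ Ideal.span {x} := Ideal.Quotient.mk _
    have hπ : Function.Surjective π := Ideal.Quotient.mk_surjective
    have : Nontrivial (R ⧸ Ideal.span {x}) := Ideal.Quotient.nontrivial_iff.mpr fun h =>
      (maximalIdeal.isMaximal R).ne_top (top_le_iff.mp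
        (h.ge.trans ((Ideal.span_singleton_le_iff_mem _).mpr (hJm hxJ))))
    have : IsLocalRing (R ⧸ Ideal.span {x}) := .of_surjective' π hπ
    have := hπ.isLocalHom π
    have := infinite_residueField_of_surjective π hπ
    have hmax : maximalIdeal (R ⧸ Ideal.span {x}) = (maximalIdeal R).map π :=
      (map_maximalIdeal_of_surjective π hπ).symm
    have hdim' : ringKrullDim (R ⧸ Ideal.span {x}) = d := by
      have := ringKrullDim_quotient_span_singleton_succ_eq_ringKrullDim hx (hJm hxJ)
      rw [hdim] at this
      push_cast at this
      exact ENat.WithBot.add_one_cancel.mp this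
    have hbs := ((isRegular_cons_iff_quotient_span x bs).mp
      ((isRegular_cons_iff R x bs).mpr ⟨hx, hbsreg⟩)).2
    obtain ⟨cs, hcslen, hcsmem, hcsreg, -, m, hm⟩ := ih (R ⧸ Ideal.span {x}) hdim'
      ⟨bs.map π, by simpa using hbslen, by
        intro r hr
        obtain ⟨b, hb, rfl⟩ := List.mem_map.mp hr
        rw [hmax]
        exact Ideal.mem_map_of_mem _ (hbsmem b hb), hbs⟩
      (J.map π) (hmax ▸ Ideal.map_mono hJm) N
      (by rw [hmax, ← Ideal.map_pow]; exact Ideal.map_mono hN)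
    obtain ⟨rs, rfl, hrs⟩ : ∃ rs : List R, rs.map π = cs ∧ ∀ r ∈ rs, r ∈ J := by
      clear hcsreg hm hcslen
      induction cs with
      | nil => exact ⟨[], rfl, by simp⟩
      | cons c cs ihc =>
        obtain ⟨rs, rfl, hrs⟩ := ihc fun r hr => hcsmem r (List.mem_cons_of_mem _ hr)
        obtain ⟨r, hr, rfl⟩ := (Ideal.mem_map_iff_of_surjective π hπ).mp (hcsmem c (by simp))
        exact ⟨r :: rs, rfl, by simpa using ⟨hr, hrs⟩⟩
    have hle : Ideal.ofList (x :: rs) ≤ J := Ideal.span_le.mpr fun r hr => by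
      rcases List.mem_cons.mp hr with rfl | h
      · exact hxJ
      · exact hrs r h
    -- In the exponent m + n₀, m serves the reduction modulo x and n₀ the superficiality of x.
    refine ⟨x :: rs, by simpa using hcslen, fun r hr => hle (Ideal.subset_span hr),
      (isRegular_cons_iff_quotient_span x rs).mpr ⟨hx, hcsreg⟩, hle, m + n₀, le_antisymm ?_ ?_⟩
    · rw [pow_succ']
      exact Ideal.mul_mono_left hle
    intro u hu
    have hm' : (J.map π) ^ (m + n₀ + 1) = Ideal.ofList (rs.map π) * (J.map π) ^ (m + n₀) := by
      rw [pow_add _ m, ← mul_assoc, hm]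
      ring
    have hu' : π u ∈ (Ideal.ofList rs * J ^ (m + n₀)).map π := by
      rw [Ideal.map_mul, Ideal.map_ofList, Ideal.map_pow, ← hm', ← Ideal.map_pow]
      exact Ideal.mem_map_of_mem _ hu
    -- Lifting gives u = v + xa with v ∈ (rs)J^(m+n₀); superficiality turns xa ∈ J^(m+n₀+1) into a ∈
    -- J^(m+n₀).
    rw [Ideal.mem_quotient_iff_mem_sup] at hu'
    obtain ⟨v, hv, w, hw, rfl⟩ := Submodule.mem_sup.mp hu'
    obtain ⟨a, rfl⟩ := Ideal.mem_span_singleton.mp hw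
    rw [Ideal.ofList_cons, Ideal.sup_mul]
    have hvJ : v ∈ J ^ (m + n₀ + 1) := by
      rw [pow_succ']
      exact Ideal.mul_mono_left (Ideal.span_le.mpr hrs) hv
    have hxa : x * a ∈ J ^ (m + n₀ + 1) := by
      simpa using Ideal.sub_mem _ hu hvJ
    have ha := hsup _ (Nat.le_add_left _ _) a hxa
    have hxa' : x * a ∈ Ideal.span {x} * J ^ (m + n₀) :=
      Ideal.mul_mem_mul (Ideal.mem_span_singleton_self x) ha
    exact add_comm v _ ▸ Submodule.add_mem_sup hxa' hv

end RegularReduction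

/-! ### The Valabrega–Valla criterion -/

section ValabregaValla

open RingTheory.Sequence

variable {R : Type*} [CommRing R]

theorem ofList_take_succ {A : Type*} [CommRing A] (rs : List A) (i : ℕ) (h : i < rs.length) :
    Ideal.ofList (rs.take (i + 1)) = Ideal.ofList (rs.take i) ⊔ Ideal.span {rs[i]} := by
  rw [← List.take_concat_get' rs i h, Ideal.ofList_append, Ideal.ofList_singleton]

theorem isWeaklyRegular_self_iff {A : Type*} [CommRing A] (rs : List A) :
    IsWeaklyRegular A rs ↔ ∀ i (h : i < rs.length), ∀ a,
      rs[i] * a ∈ Ideal.ofList (rs.take i) → a ∈ Ideal.ofList (rs.take i) := by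
  have key : ∀ i (h : i < rs.length),
      IsSMulRegular (A ⧸ (Ideal.ofList (rs.take i) • ⊤ : Ideal A)) rs[i] ↔
        ∀ a, rs[i] * a ∈ Ideal.ofList (rs.take i) → a ∈ Ideal.ofList (rs.take i) := by
    intro i h
    rw [isSMulRegular_quotient_iff_mem_of_smul_mem]
    simp
  exact ⟨fun h i hi => (key i hi).mp (h.regular_mod_prev i hi),
    fun h => ⟨fun i hi => (key i hi).mpr (h i hi)⟩⟩

theorem ofList_take_le {I : Ideal R} {rs : List R} (hmem : ∀ r ∈ rs, r ∈ I) (i : ℕ) :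
    Ideal.ofList (rs.take i) ≤ I :=
  Ideal.span_le.mpr fun _ hr => hmem _ (List.mem_of_mem_take hr)

/-- If `(x₁, …, x_r) ∩ Iⁿ⁺¹ = (x₁, …, x_r) Iⁿ` for all `n` and the sequence is regular, then
the same holds for its initial segments. -/
theorem inf_ofList_take_le {I : Ideal R} {rs : List R} (hmem : ∀ r ∈ rs, r ∈ I)
    (hreg : IsWeaklyRegular R rs)
    (h : ∀ n, I ^ (n + 1) ⊓ Ideal.ofList rs ≤ Ideal.ofList rs * I ^ n)
    (i : ℕ) (hi : i ≤ rs.length) (n : ℕ) :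
    I ^ (n + 1) ⊓ Ideal.ofList (rs.take i) ≤ Ideal.ofList (rs.take i) * I ^ n := by
  induction hi using Nat.decreasingInduction generalizing n with
  | self => simpa using h n
  | of_succ i hi ih =>
    induction n with
    | zero => simp
    | succ n ihn =>
      rintro a ⟨haI, haL⟩
      have hle : Ideal.ofList (rs.take i) ≤ Ideal.ofList (rs.take (i + 1)) := by
        rw [ofList_take_succ rs i hi]; exact le_sup_left
      have h1 := ih (n + 1) ⟨haI, hle haL⟩
      rw [ofList_take_succ rs i hi, Ideal.sup_mul] at h1
      obtain ⟨u, hu, v, hv, rfl⟩ := Submodule.mem_sup.mp h1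
      obtain ⟨b, hb, rfl⟩ := Ideal.mem_span_singleton_mul.mp hv
      -- Regularity modulo the shorter segment puts b in it; the induction on n then applies to b.
      have hbL : b ∈ Ideal.ofList (rs.take i) := by
        refine (isWeaklyRegular_self_iff rs).mp hreg i hi b ?_
        simpa using Ideal.sub_mem _ haL (Ideal.mul_le_left hu)
      have hb' := ihn ⟨hb, hbL⟩
      refine Ideal.add_mem _ hu ?_
      rw [pow_succ, ← mul_assoc, mul_comm rs[i]]
      exact Ideal.mul_mem_mul hb' (hmem _ (List.getElem_mem hi))

/-- The ideal of the Rees algebra of `I` whose image in `gr(I)` is generated by the initial forms of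
degree one of the elements of `L ⊆ I`. -/
def reesInitialIdeal (I L : Ideal R) : Ideal (reesAlgebra I) where
  carrier := {f | ∀ n, (f : R[X]).coeff n ∈ L * I ^ (n - 1) ⊔ I ^ (n + 1)}
  add_mem' hf hg n := by
    simpa using Ideal.add_mem _ (hf n) (hg n)
  zero_mem' n := by simp
  smul_mem' c f hf n := by
    simp only [smul_eq_mul, MulMemClass.coe_mul, coeff_mul]
    refine Ideal.sum_mem _ ?_
    rintro ⟨j, k⟩ e
    rw [← Finset.HasAntidiagonal.mem_antidiagonal.mp e]
    have h := Ideal.mul_mem_mul (c.2 j) (hf k)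
    rw [Ideal.mul_sup, ← mul_assoc, mul_comm _ L, mul_assoc, ← pow_add, ← pow_add] at h
    -- Truncated subtraction at k = 0 can only make the left exponent larger, as needed.
    have h1 : L * I ^ (j + (k - 1)) ≤ L * I ^ (j + k - 1) :=
      Ideal.mul_mono_right (Ideal.pow_le_pow_right (by omega))
    exact (sup_le_sup h1 (Ideal.pow_le_pow_right (by omega))) h

theorem reesShift_le_reesInitialIdeal (I L : Ideal R) : reesShift I ≤ reesInitialIdeal I L :=
  fun _ hf n => Ideal.mem_sup_right (hf n)

/-- Both ideals are homogeneous, so comparison reduces to monomials. This makes membership in an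
ideal of initial forms a condition on coefficients. -/
theorem ofList_sup_reesShift (I : Ideal R) (xs : List I) :
    Ideal.ofList (xs.map (reesDegreeOne I)) ⊔ reesShift I =
      reesInitialIdeal I (Ideal.ofList (xs.map Subtype.val)) := by
  apply le_antisymm
  · refine sup_le (Ideal.span_le.mpr ?_) (reesShift_le_reesInitialIdeal _ _)
    intro t ht n
    obtain ⟨x, hx, rfl⟩ := List.mem_map.mp ht
    rw [coe_reesDegreeOne, coeff_monomial]
    split_ifs with h
    · subst h
      have hxL : (x : R) ∈ Ideal.ofList (xs.map Subtype.val) :=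
        Ideal.subset_span (List.mem_map.mpr ⟨x, hx, rfl⟩)
      exact Ideal.mem_sup_left (by simpa using hxL)
    · exact zero_mem _
  · intro f hf
    set T := Ideal.ofList (xs.map (reesDegreeOne I)) ⊔ reesShift I with hT
    have hL : Ideal.ofList (xs.map Subtype.val) ≤ I := by
      refine Ideal.span_le.mpr fun t ht => ?_
      obtain ⟨x, -, rfl⟩ := List.mem_map.mp ht
      exact x.2
    have hshift : ∀ n (a : R) (ha : a ∈ I ^ n), a ∈ I ^ (n + 1) →
        (⟨monomial n a, reesAlgebra.monomial_mem.mpr ha⟩ : reesAlgebra I) ∈ T := by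
      intro n a ha ha'
      refine Ideal.mem_sup_right (mem_reesShift.mpr fun m => ?_)
      rw [coeff_monomial]
      split_ifs with h
      · subst h; exact ha'
      · exact zero_mem _
    have hgen : ∀ n, ∀ l ∈ Ideal.ofList (xs.map Subtype.val), ∀ b ∈ I ^ n,
        ∃ h : l * b ∈ I ^ (n + 1),
          (⟨monomial (n + 1) (l * b), reesAlgebra.monomial_mem.mpr h⟩ : reesAlgebra I) ∈ T := by
      intro n l hl b hb
      have hmul : ∀ l ∈ Ideal.ofList (xs.map Subtype.val), l * b ∈ I ^ (n + 1) := fun l hl => by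
        rw [pow_succ']; exact Ideal.mul_mem_mul (hL hl) hb
      refine ⟨hmul l hl, ?_⟩
      induction hl using Submodule.span_induction with
      | mem l hl =>
        obtain ⟨x, hx, rfl⟩ := List.mem_map.mp hl
        have h1 : reesDegreeOne I x ∈ T :=
          Ideal.mem_sup_left (Ideal.subset_span (List.mem_map.mpr ⟨x, hx, rfl⟩))
        convert Ideal.mul_mem_right
          (⟨monomial n b, reesAlgebra.monomial_mem.mpr hb⟩ : reesAlgebra I) _ h1 using 1
        exact Subtype.ext (by simp [coe_reesDegreeOne, monomial_mul_monomial, add_comm])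
      | zero =>
        convert zero_mem T using 1
        exact Subtype.ext (by simp)
      | add u v hu hv h1 h2 =>
        convert Ideal.add_mem _ h1 h2 using 1
        exact Subtype.ext (by simp [add_mul])
      | smul r u hu h1 =>
        convert Ideal.mul_mem_left T (algebraMap R (reesAlgebra I) r) h1 using 1
        exact Subtype.ext (by simp [mul_assoc])
    have hLT : ∀ n, ∀ a ∈ Ideal.ofList (xs.map Subtype.val) * I ^ n, ∃ h : a ∈ I ^ (n + 1),
        (⟨monomial (n + 1) a, reesAlgebra.monomial_mem.mpr h⟩ : reesAlgebra I) ∈ T := by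
      intro n a ha
      induction ha using Submodule.mul_induction_on' with
      | mem_mul_mem l hl b hb => exact hgen n l hl b hb
      | add u hu v hv h1 h2 =>
        obtain ⟨h1, h1'⟩ := h1
        obtain ⟨h2, h2'⟩ := h2
        refine ⟨Ideal.add_mem _ h1 h2, ?_⟩
        convert Ideal.add_mem _ h1' h2' using 1
        exact Subtype.ext (by simp)
    have hmon : ∀ n, (⟨monomial n ((f : R[X]).coeff n), reesAlgebra.monomial_mem.mpr (f.2 n)⟩ :
        reesAlgebra I) ∈ T := by
      intro n
      obtain ⟨u, hu, v, hv, huv⟩ := Submodule.mem_sup.mp (hf n)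
      -- In degree 0 the inclusion L ⊆ I already puts the coefficient in I.
      rcases n with _ | n
      · refine hshift 0 _ (f.2 0) ?_
        rw [← huv]
        exact Ideal.add_mem _ (by simpa using hL (by simpa using hu)) hv
      · obtain ⟨h1, h1'⟩ := hLT n u hu
        have h2 : v ∈ I ^ (n + 1) := Ideal.pow_le_pow_right (by omega) hv
        convert Ideal.add_mem _ h1' (hshift (n + 1) v h2 hv) using 1
        exact Subtype.ext (by simp [← huv])
    have hsum : f = ∑ n ∈ (f : R[X]).support,
        (⟨monomial n ((f : R[X]).coeff n), reesAlgebra.monomial_mem.mpr (f.2 n)⟩ :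
          reesAlgebra I) := by
      apply Subtype.ext
      rw [AddSubmonoidClass.coe_finsetSum]
      exact (f : R[X]).as_sum_support
    rw [hsum]
    exact Ideal.sum_mem _ fun n _ => hmon n

/-- The initial forms of degree one of a regular sequence `x₁, …, x_r` in `I` are a
regular sequence in `gr(I)` if `(x₁, …, x_r) ∩ Iⁿ⁺¹ = (x₁, …, x_r) Iⁿ` for all `n`. -/
theorem isRegular_initialForms {I : Ideal R} (hI : I ≠ ⊤) (xs : List I)
    (hreg : IsWeaklyRegular R (xs.map Subtype.val))
    (h : ∀ n, I ^ (n + 1) ⊓ Ideal.ofList (xs.map Subtype.val) ≤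
      Ideal.ofList (xs.map Subtype.val) * I ^ n) :
    IsRegular (AssocGraded I)
      ((xs.map (reesDegreeOne I)).map (Ideal.Quotient.mk (reesShift I))) := by
  have hmem : ∀ r ∈ xs.map Subtype.val, r ∈ I := by
    intro r hr
    obtain ⟨x, -, rfl⟩ := List.mem_map.mp hr
    exact x.2
  have hiff : ∀ (i : ℕ) (f : reesAlgebra I), Ideal.Quotient.mk (reesShift I) f ∈
      Ideal.ofList (((xs.map (reesDegreeOne I)).map (Ideal.Quotient.mk (reesShift I))).take i) ↔
      f ∈ reesInitialIdeal I (Ideal.ofList ((xs.map Subtype.val).take i)) := by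
    intro i f
    rw [← List.map_take, ← Ideal.map_ofList, Ideal.mem_quotient_iff_mem_sup, ← List.map_take,
      ofList_sup_reesShift, List.map_take]
  refine ⟨(isWeaklyRegular_self_iff _).mpr fun i hi a ha => ?_, fun htop => ?_⟩
  · obtain ⟨f, rfl⟩ := Ideal.Quotient.mk_surjective a
    have hi' : i < (xs.map Subtype.val).length := by simpa using hi
    have hi'' : i < xs.length := by simpa using hi
    rw [List.getElem_map, ← map_mul, hiff] at ha
    rw [hiff]
    intro n
    have hn := ha (n + 1)
    have hcoeff : ((((xs.map (reesDegreeOne I))[i]'(by simpa using hi) * f : reesAlgebra I) :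
        R[X])).coeff (n + 1) = (xs.map Subtype.val)[i] * (f : R[X]).coeff n := by
      simp [coe_reesDegreeOne, ← C_mul_X_eq_monomial, mul_assoc]
    rw [hcoeff] at hn
    set L := Ideal.ofList ((xs.map Subtype.val).take i)
    set x := (xs.map Subtype.val)[i]
    have hxI : x ∈ I := hmem _ (List.getElem_mem hi')
    -- Write aₙ for the coefficient of f. Here x aₙ = u + v with u ∈ L Iⁿ and v ∈ Iⁿ⁺² ∩ (L + (x)).
    -- The intersection condition gives v = w + xc with c ∈ Iⁿ⁺¹, so x(aₙ - c) ∈ L and aₙ - c ∈ L ∩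
    -- Iⁿ.
    obtain ⟨u, hu, v, hv, huv⟩ := Submodule.mem_sup.mp hn
    rw [Nat.add_sub_cancel] at hu
    have hv' : v ∈ Ideal.ofList ((xs.map Subtype.val).take (i + 1)) := by
      have hle := ofList_take_succ _ i hi'
      have h1 : x * (f : R[X]).coeff n ∈ Ideal.ofList ((xs.map Subtype.val).take (i + 1)) :=
        Ideal.mul_mem_right _ _ ((le_sup_right.trans hle.ge) (Ideal.mem_span_singleton_self x))
      have h2 : u ∈ Ideal.ofList ((xs.map Subtype.val).take (i + 1)) :=
        (le_sup_left.trans hle.ge) (Ideal.mul_le_left hu)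
      rw [← add_sub_cancel_left u v, huv]
      exact Ideal.sub_mem _ h1 h2
    have hv'' := inf_ofList_take_le hmem hreg h (i + 1) hi' (n + 1) ⟨hv, hv'⟩
    rw [ofList_take_succ _ i hi', Ideal.sup_mul] at hv''
    obtain ⟨w, hw, z, hz, hwz⟩ := Submodule.mem_sup.mp hv''
    obtain ⟨c, hc, rfl⟩ := Ideal.mem_span_singleton_mul.mp hz
    have hacL : (f : R[X]).coeff n - c ∈ L := by
      refine (isWeaklyRegular_self_iff _).mp hreg i hi' _ ?_
      have : x * ((f : R[X]).coeff n - c) = u + w := by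
        rw [mul_sub, ← huv, ← hwz]; ring
      rw [this]
      exact Ideal.add_mem _ (Ideal.mul_le_left hu) (Ideal.mul_le_left hw)
    have hac : (f : R[X]).coeff n - c ∈ L * I ^ (n - 1) := by
      rcases n with _ | n
      · simpa using hacL
      · exact inf_ofList_take_le hmem hreg h i hi'.le n
          ⟨Ideal.sub_mem _ (f.2 _) (Ideal.pow_le_pow_right (by omega) hc), hacL⟩
    rw [← sub_add_cancel ((f : R[X]).coeff n) c]
    exact Ideal.add_mem _ (Ideal.mem_sup_left hac) (Ideal.mem_sup_right hc)
  -- If the initial forms generated the unit ideal, the constant coefficient 1 would lie in I.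
  · have h1 : Ideal.Quotient.mk (reesShift I) 1 ∈
        Ideal.ofList ((xs.map (reesDegreeOne I)).map (Ideal.Quotient.mk (reesShift I))) := by
      rw [smul_eq_mul, Ideal.mul_top] at htop
      rw [← htop]; trivial
    have h2 := hiff (xs.length) 1
    rw [List.take_of_length_le (by simp), List.take_of_length_le (by simp)] at h2
    have h3 := h2.mp h1 0
    refine hI ((Ideal.eq_top_iff_one I).mpr ?_)
    have hL : Ideal.ofList (xs.map Subtype.val) ≤ I := Ideal.span_le.mpr hmem
    have hle : Ideal.ofList (xs.map Subtype.val) * I ^ (0 - 1) ⊔ I ^ (0 + 1) ≤ I :=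
      sup_le (Ideal.mul_le_left.trans hL) (by simp)
    have h4 : ((1 : reesAlgebra I) : R[X]).coeff 0 = 1 := by simp
    exact h4 ▸ hle h3

theorem length_le_depthGr [IsLocalRing R] {I : Ideal R} (hI : I ≠ ⊤) {rs : List R}
    (hmem : ∀ r ∈ rs, r ∈ I) (hreg : IsWeaklyRegular R rs)
    (h : ∀ n, I ^ (n + 1) ⊓ Ideal.ofList rs ≤ Ideal.ofList rs * I ^ n) :
    (rs.length : ℕ∞) ≤ depthGr I := by
  lift rs to List I using hmem
  have hr := isRegular_initialForms hI rs hreg h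
  rw [depthGr, depthIn]
  refine le_iSup₂_of_le _ ⟨?_, hr⟩ (by simp)
  intro t ht
  obtain ⟨f, hf, rfl⟩ := List.mem_map.mp ht
  obtain ⟨x, -, rfl⟩ := List.mem_map.mp hf
  refine Ideal.mem_map_of_mem _ ?_
  simp [reesMaximalIdeal, coe_reesDegreeOne, coeff_monomial]

end ValabregaValla

/-! ### Reduction number at most one -/

section ReductionNumber

open RingTheory.Sequence

/-- A finite supremum of naturals is attained; d ≠ 0 excludes the empty supremum. -/
theorem exists_isRegular_of_depthIn_eq {A : Type*} [CommRing A] {𝔞 : Ideal A} {d : ℕ}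
    (hd : d ≠ 0) (h : depthIn 𝔞 = d) :
    ∃ rs : List A, rs.length = d ∧ (∀ r ∈ rs, r ∈ 𝔞) ∧ IsRegular A rs := by
  by_contra! hne
  have hle : depthIn 𝔞 ≤ ((d - 1 : ℕ) : ℕ∞) := by
    refine iSup₂_le fun rs hrs => ?_
    have h1 : (rs.length : ℕ∞) ≤ d := h ▸ le_iSup₂_of_le rs hrs le_rfl
    have h2 : rs.length ≠ d := fun hlen => hne rs hlen hrs.1 hrs.2
    have h3 : rs.length ≤ d := by exact_mod_cast h1
    exact_mod_cast (by omega : rs.length ≤ d - 1)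
  rw [h] at hle
  have : d ≤ d - 1 := by exact_mod_cast hle
  omega

theorem mul_pow_reductionNumberWrt {R : Type*} [CommRing R] {J I : Ideal R} (h : IsReduction J I) :
    J * I ^ reductionNumberWrt J I = I ^ (reductionNumberWrt J I + 1) :=
  Nat.sInf_mem h.2

/-- In a Cohen–Macaulay local ring with infinite residue field, the associated graded ring of an
`𝔪`-primary ideal of reduction number at most one is Cohen–Macaulay. -/
theorem le_depthGr_of_reductionNumber_le_one {R : Type*} [CommRing R] [IsLocalRing R]
    [Infinite (ResidueField R)] (hCM : IsCohenMacaulayLocalRing R) {d : ℕ} (hd : d ≠ 0)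
    (hdim : ringKrullDim R = d) {I : Ideal R} (hI : IsMaximalPrimary I)
    (hr : reductionNumber I ≤ 1) : (d : ℕ∞) ≤ depthGr I := by
  have := hCM.isNoetherianRing
  have hItop : I ≠ ⊤ := hI.1.ne_top
  obtain ⟨J₀, hJ₀⟩ := exists_isMinimalReduction hI.2
  -- Existence of J₀ ensures that `sInf` is attained and is not the default 0 of the empty set.
  obtain ⟨J, hJ, hrJ⟩ : ∃ J : Ideal R, IsMinimalReduction J I ∧
      reductionNumber I = reductionNumberWrt J I :=
    Nat.sInf_mem (s := {r | ∃ J : Ideal R, IsMinimalReduction J I ∧ r = reductionNumberWrt J I})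
      ⟨_, J₀, hJ₀, rfl⟩
  have hJI := hJ.prop
  have hJI2 : J * I = I ^ 2 := by
    have h := mul_pow_reductionNumberWrt hJI
    rw [← hrJ] at h
    interval_cases hred : reductionNumber I
    · have hJeq : J = I := by simpa using h
      rw [hJeq, sq]
    · simpa using h
  have hJpow : ∀ n, J * I ^ (n + 1) = I ^ (n + 2) := by
    intro n
    rw [pow_succ', ← mul_assoc, hJI2, ← pow_add, add_comm]
  have hmJ : maximalIdeal R ≤ J.radical := by
    obtain ⟨n, hn⟩ := hJI.2
    rw [← hI.2, ← Ideal.radical_pow I (Nat.succ_ne_zero n), ← hn]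
    exact Ideal.radical_mono Ideal.mul_le_left
  obtain ⟨N, hN⟩ := Ideal.exists_pow_le_of_le_radical_of_fg hmJ (IsNoetherian.noetherian _)
  have hdepth : depthIn (maximalIdeal R) = d := by
    have := hCM.depth_eq_dim
    rw [hdim] at this
    exact_mod_cast this
  obtain ⟨rs, hlen, hmem, hreg, hred⟩ := exists_isRegular_isReduction d R hdim
    (exists_isRegular_of_depthIn_eq hd hdepth) J (hJI.1.trans (le_maximalIdeal hItop)) N hN
  -- A reduction of J is a reduction of I, so minimality of J forces equality.
  have hJrs : Ideal.ofList rs = J :=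
    le_antisymm hred.1 (hJ.le_of_le (hred.trans hJI) hred.1)
  rw [← hlen]
  refine length_le_depthGr hItop (fun r hr => hJI.1 (hmem r hr)) hreg.toIsWeaklyRegular fun n => ?_
  rw [hJrs]
  rcases n with _ | n
  · simp
  · rw [hJpow]
    exact inf_le_left

end ReductionNumber

theorem proposition3p14 {R : Type*} [CommRing R] [IsLocalRing R]
    [Infinite (IsLocalRing.ResidueField R)]
    (hCM : IsCohenMacaulayLocalRing R)
    (d : ℕ) (hd : 3 ≤ d) (hdim : ringKrullDim R = d)
    (I : Ideal R) (hI : IsMaximalPrimary I)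
    (hdepth : depthGr I = ((d - 2 : ℕ) : ℕ∞))
    (hn : postulationNumber I < -((d : ℤ) - 3)) :
    postulationNumber I + (d : ℤ) ≤ (reductionNumber I : ℤ) := by
  by_contra! hlt
  -- The last `omega` derives rd(I) ≤ 1 from rd(I) < n(I) + d < 3.
  have h := le_depthGr_of_reductionNumber_le_one hCM (by omega) hdim hI (by omega)
  rw [hdepth] at h
  have : d ≤ d - 2 := by exact_mod_cast h
  omega
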